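/- Let $n\ge 0$ be an integer and let $k_1,\dots,k_n$, $w_1,\dots,w_n$, $\eta_1^{(0)},\dots,\eta_n^{(0)}$ be real numbers with $w_i^2=k_i^2\left(1-\tfrac13 k_i^2\right)$ for every $i$. For $i<j$ put $$R_{ij}=-\frac{(w_i-w_j)^2-(k_i-k_j)^2+\frac13(k_i-k_j)^4}{(w_i+w_j)^2-(k_i+k_j)^2+\frac13(k_i+k_j)^4},$$ and assume that, for all $i<j$, the denominator is non-zero and $R_{ij}>0$. Put $A_{ij}=\log|R_{ij}|$, so that $e^{A_{ij}}=R_{ij}$, and $\eta_i(x,t)=k_ix+w_it+\eta_i^{(0)}$. Then $$u(x,t)=2\,\frac{\partial^2}{\partial x^2}\log\sum_{\mu\in\{0,1\}^n}\exp\Big(\sum_{i=1}^n\mu_i\eta_i(x,t)+\sum_{1\le i<j\le n}\mu_i\mu_jA_{ij}\Big)$$ is a classical ($C^4$) solution on $\mathbb R^2$ of the good Boussinesq equation $$u_{tt}-u_{xx}+(u^2)_{xx}+\tfrac13u_{xxxx}=0.$$ -/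

import Mathlib

/-- `u = u(x, t)` is a classical solution, on the whole `(x, t)`-plane, of the good Boussinesq
equation `u_tt - u_xx + (u²)_xx + (1/3) u_xxxx = 0`. The `C⁴` clause makes every derivative in the
equation a genuine one. -/
def IsGoodBoussinesqSolution (u : ℝ → ℝ → ℝ) : Prop :=
  ContDiff ℝ 4 (fun p : ℝ × ℝ => u p.1 p.2) ∧
  ∀ x t : ℝ,
    iteratedDeriv 2 (fun s => u x s) t - iteratedDeriv 2 (fun y => u y t) x
      + iteratedDeriv 2 (fun y => (u y t) ^ 2) x
      + (1 / 3 : ℝ) * iteratedDeriv 4 (fun y => u y t) x = 0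

/-- The phase-shift ratio of two solitons with wave numbers `k₁, k₂` and frequencies `w₁, w₂`. -/
noncomputable def phaseRatio (k₁ w₁ k₂ w₂ : ℝ) : ℝ :=
  -(((w₁ - w₂) ^ 2 - (k₁ - k₂) ^ 2 + (1 / 3 : ℝ) * (k₁ - k₂) ^ 4) /
    ((w₁ + w₂) ^ 2 - (k₁ + k₂) ^ 2 + (1 / 3 : ℝ) * (k₁ + k₂) ^ 4))

/-- The phase shift `A_ij`, the logarithm of the absolute value of the phase-shift ratio. -/
noncomputable def phaseShift {n : ℕ} (k w : Fin n → ℝ) (i j : Fin n) : ℝ :=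
  Real.log |phaseRatio (k i) (w i) (k j) (w j)|

/-- The phase `η_i = k_i x + w_i t + η_i⁰`. -/
def solitonPhase {n : ℕ} (k w η₀ : Fin n → ℝ) (x t : ℝ) (i : Fin n) : ℝ :=
  k i * x + w i * t + η₀ i

/-- The sum over `μ ∈ {0,1}ⁿ` of `exp (∑ᵢ μᵢ ηᵢ + ∑_{i<j} μᵢ μⱼ A_ij)`. -/
noncomputable def solitonTau {n : ℕ} (k w η₀ : Fin n → ℝ) (x t : ℝ) : ℝ :=
  ∑ μ : Fin n → Fin 2,
    Real.exp (∑ i, ((μ i : ℕ) : ℝ) * solitonPhase k w η₀ x t i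
      + ∑ i, ∑ j ∈ Finset.Ioi i,
          ((μ i : ℕ) : ℝ) * ((μ j : ℕ) : ℝ) * phaseShift k w i j)

/-- The `n`-soliton `u = 2 (log F)_xx`. -/
noncomputable def nSoliton {n : ℕ} (k w η₀ : Fin n → ℝ) (x t : ℝ) : ℝ :=
  2 * iteratedDeriv 2 (fun y => Real.log (solitonTau k w η₀ y t)) x

/-! With `F` the sum of exponentials and `u = 2 (log F)_xx`, the equation for `u` follows from
Hirota's bilinear equation for `F` (`isGoodBoussinesqSolution_of_bilinear`). For a sum of
exponentials the bilinear equation says that a double sum over `μ, ν`, weighted by the dispersion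
quartic at the differences of wave numbers and frequencies, vanishes (`isBilinear_expSum`).

To evaluate it, write `k = p - q`, `w = p² - q²` with `p² + p q + q² = 3/4`. Then `p³ - q³ = (3/4)(p
- q)`, so three times the quartic is the KP form in the power sums of two families of points, each
choosing `q i` or `p i` for every `i` (`three_mul_dispersion_eq_kpForm`). The ratio `R_ij` becomes a
cross-ratio, so the soliton coefficients are Vandermonde determinants of the chosen points, up to a
constant and product weights (`exists_vandermonde_weights`).

The KP form times two Vandermondes is a Plücker-type combination of alternants
(`kpForm_mul_vandermonde`). By multilinearity, summing over all choices turns the alternants into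
minors built on one common matrix, and the Plücker relation annihilates the total
(`sum_kpForm_eq_zero`). -/

open scoped ContDiff

/-! ### Directional derivatives of smooth functions on the plane. -/

/-- The derivative of `f` in the direction `v`. -/
noncomputable def dirDeriv (v : ℝ × ℝ) (f : ℝ × ℝ → ℝ) (p : ℝ × ℝ) : ℝ := fderiv ℝ f p v

theorem ContDiff.dirDeriv {f : ℝ × ℝ → ℝ} (hf : ContDiff ℝ ∞ f) (v : ℝ × ℝ) :
    ContDiff ℝ ∞ (dirDeriv v f) :=
  (hf.fderiv_right (m := ∞) (by simp)).clm_apply contDiff_const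

theorem ContDiff.differentiableAt_of_smooth {f : ℝ × ℝ → ℝ} (hf : ContDiff ℝ ∞ f) (p : ℝ × ℝ) :
    DifferentiableAt ℝ f p :=
  (hf.differentiable (by simp)) p

theorem ContDiff.pi_add {f g : ℝ × ℝ → ℝ} (hf : ContDiff ℝ ∞ f) (hg : ContDiff ℝ ∞ g) :
    ContDiff ℝ ∞ (f + g) :=
  hf.add hg

theorem ContDiff.pi_mul {f g : ℝ × ℝ → ℝ} (hf : ContDiff ℝ ∞ f) (hg : ContDiff ℝ ∞ g) :
    ContDiff ℝ ∞ (f * g) :=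
  hf.mul hg

theorem ContDiff.pi_smul {f : ℝ × ℝ → ℝ} (hf : ContDiff ℝ ∞ f) (c : ℝ) :
    ContDiff ℝ ∞ (c • f) :=
  hf.const_smul c

theorem dirDeriv_add {f g : ℝ × ℝ → ℝ} (hf : ContDiff ℝ ∞ f) (hg : ContDiff ℝ ∞ g) (v : ℝ × ℝ) :
    dirDeriv v (f + g) = dirDeriv v f + dirDeriv v g := by
  funext p
  simp [dirDeriv, fderiv_add (hf.differentiableAt_of_smooth p) (hg.differentiableAt_of_smooth p)]

theorem dirDeriv_smul {f : ℝ × ℝ → ℝ} (hf : ContDiff ℝ ∞ f) (c : ℝ) (v : ℝ × ℝ) :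
    dirDeriv v (c • f) = c • dirDeriv v f := by
  funext p
  simp [dirDeriv, fderiv_const_smul (hf.differentiableAt_of_smooth p)]

theorem dirDeriv_mul {f g : ℝ × ℝ → ℝ} (hf : ContDiff ℝ ∞ f) (hg : ContDiff ℝ ∞ g) (v : ℝ × ℝ) :
    dirDeriv v (f * g) = f * dirDeriv v g + g * dirDeriv v f := by
  funext p
  simp [dirDeriv, fderiv_mul (hf.differentiableAt_of_smooth p) (hg.differentiableAt_of_smooth p)]

theorem dirDeriv_comm {f : ℝ × ℝ → ℝ} (hf : ContDiff ℝ ∞ f) (v w : ℝ × ℝ) :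
    dirDeriv v (dirDeriv w f) = dirDeriv w (dirDeriv v f) := by
  have hd : Differentiable ℝ (fderiv ℝ f) :=
    (hf.fderiv_right (m := ∞) (by simp)).differentiable (by simp)
  have key : ∀ v w p, dirDeriv v (dirDeriv w f) p = fderiv ℝ (fderiv ℝ f) p v w := by
    intro v w p
    have := (hd p).hasFDerivAt.clm_apply (hasFDerivAt_const w p)
    show fderiv ℝ (fun q => fderiv ℝ f q w) p v = _
    rw [this.fderiv]
    simp
  funext p
  rw [key, key]
  exact (hf.contDiffAt.isSymmSndFDerivAt (by simp; norm_cast)).eq v w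

theorem iteratedDeriv_fst_slice {f : ℝ × ℝ → ℝ} (hf : ContDiff ℝ ∞ f) (n : ℕ) (x t : ℝ) :
    iteratedDeriv n (fun y => f (y, t)) x = (dirDeriv (1, 0))^[n] f (x, t) := by
  induction n generalizing f with
  | zero => simp
  | succ n ih =>
    rw [iteratedDeriv_succ', Function.iterate_succ_apply, ← ih (hf.dirDeriv _)]
    congr 1
    funext y
    have h := (hf.differentiableAt_of_smooth (y, t)).hasFDerivAt.comp_hasDerivAt y
      ((hasDerivAt_id y).prodMk (hasDerivAt_const y t))
    exact h.deriv

theorem iteratedDeriv_snd_slice {f : ℝ × ℝ → ℝ} (hf : ContDiff ℝ ∞ f) (n : ℕ) (x t : ℝ) :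
    iteratedDeriv n (fun s => f (x, s)) t = (dirDeriv (0, 1))^[n] f (x, t) := by
  induction n generalizing f with
  | zero => simp
  | succ n ih =>
    rw [iteratedDeriv_succ', Function.iterate_succ_apply, ← ih (hf.dirDeriv _)]
    congr 1
    funext s
    have h := (hf.differentiableAt_of_smooth (x, s)).hasFDerivAt.comp_hasDerivAt s
      ((hasDerivAt_const s x).prodMk (hasDerivAt_id s))
    exact h.deriv

/-! ### From the bilinear equation to the Boussinesq equation. -/

/-- Hirota's bilinear form `(D_t² - D_x² + (1/3) D_x⁴) F · F = 0` of the good Boussinesq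
equation. -/
def IsBilinearBoussinesqSolution (F : ℝ × ℝ → ℝ) : Prop :=
  ∀ p,
    F p * (dirDeriv (0, 1))^[2] F p - dirDeriv (0, 1) F p ^ 2
      - (F p * (dirDeriv (1, 0))^[2] F p - dirDeriv (1, 0) F p ^ 2)
      + (1 / 3 : ℝ) * (F p * (dirDeriv (1, 0))^[4] F p
        - 4 * dirDeriv (1, 0) F p * (dirDeriv (1, 0))^[3] F p
        + 3 * (dirDeriv (1, 0))^[2] F p ^ 2) = 0

/-- Each derivative of `F = exp φ` is `F` times a polynomial in derivatives of `φ`. In the bilinear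
form every term containing a first derivative of `φ` cancels. The result is an identity of
functions, so it can be differentiated further. -/
theorem log_bilinear {F φ : ℝ × ℝ → ℝ} (hF : ContDiff ℝ ∞ F) (hφ : ContDiff ℝ ∞ φ)
    (hpos : ∀ p, 0 < F p) (hlog : ∀ v, dirDeriv v F = F * dirDeriv v φ)
    (hbil : IsBilinearBoussinesqSolution F) :
    (dirDeriv (0, 1))^[2] φ + (-1 : ℝ) • (dirDeriv (1, 0))^[2] φ
      + (1 / 3 : ℝ) • (dirDeriv (1, 0))^[4] φ
      + (2 : ℝ) • ((dirDeriv (1, 0))^[2] φ * (dirDeriv (1, 0))^[2] φ) = 0 := by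
  have s1 : ∀ v, ContDiff ℝ ∞ (dirDeriv v φ) := fun v => hφ.dirDeriv v
  have s2 : ∀ v, ContDiff ℝ ∞ (dirDeriv v (dirDeriv v φ)) := fun v => (s1 v).dirDeriv v
  have s3 : ∀ v, ContDiff ℝ ∞ (dirDeriv v (dirDeriv v (dirDeriv v φ))) :=
    fun v => (s2 v).dirDeriv v
  have F2 : ∀ v, dirDeriv v (dirDeriv v F)
      = F * (dirDeriv v (dirDeriv v φ) + dirDeriv v φ * dirDeriv v φ) := by
    intro v
    rw [hlog v, dirDeriv_mul hF (s1 v), hlog v]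
    ring
  have F3 : ∀ v, dirDeriv v (dirDeriv v (dirDeriv v F))
      = F * (dirDeriv v (dirDeriv v (dirDeriv v φ)) + 3 * (dirDeriv v φ * dirDeriv v (dirDeriv v φ))
        + dirDeriv v φ * (dirDeriv v φ * dirDeriv v φ)) := by
    intro v
    rw [F2 v, dirDeriv_mul hF ((s2 v).pi_add ((s1 v).pi_mul (s1 v))),
      dirDeriv_add (s2 v) ((s1 v).pi_mul (s1 v)), dirDeriv_mul (s1 v) (s1 v), hlog v]
    ring
  have F4 : ∀ v, dirDeriv v (dirDeriv v (dirDeriv v (dirDeriv v F)))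
      = F * (dirDeriv v (dirDeriv v (dirDeriv v (dirDeriv v φ)))
        + 4 * (dirDeriv v φ * dirDeriv v (dirDeriv v (dirDeriv v φ)))
        + 3 * dirDeriv v (dirDeriv v φ) ^ 2 + 6 * dirDeriv v φ ^ 2 * dirDeriv v (dirDeriv v φ)
        + dirDeriv v φ ^ 4) := by
    intro v
    have three : (3 * (dirDeriv v φ * dirDeriv v (dirDeriv v φ)))
        = (3 : ℝ) • (dirDeriv v φ * dirDeriv v (dirDeriv v φ)) := by
      funext p; simp
    have a := (s1 v).pi_mul (s2 v)
    have b := (s1 v).pi_mul (s1 v)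
    rw [F3 v, three, dirDeriv_mul hF (((s3 v).pi_add (a.pi_smul (3 : ℝ))).pi_add ((s1 v).pi_mul b)),
      dirDeriv_add ((s3 v).pi_add (a.pi_smul (3 : ℝ))) ((s1 v).pi_mul b),
      dirDeriv_add (s3 v) (a.pi_smul (3 : ℝ)), dirDeriv_smul a,
      dirDeriv_mul (s1 v) (s2 v), dirDeriv_mul (s1 v) b, dirDeriv_mul (s1 v) (s1 v), hlog v]
    funext p
    simp
    ring
  funext p
  have h := hbil p
  simp only [Function.iterate_succ, Function.iterate_zero, Function.comp, id] at h ⊢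
  simp only [F4] at h
  simp only [F3] at h
  simp only [F2] at h
  simp only [hlog, Pi.mul_apply, Pi.add_apply, Pi.pow_apply, Pi.ofNat_apply] at h
  have hF2 : F p ^ 2 ≠ 0 := pow_ne_zero _ (hpos p).ne'
  simp only [Pi.mul_apply, Pi.add_apply, Pi.smul_apply, smul_eq_mul, Pi.zero_apply]
  apply mul_left_cancel₀ hF2
  linear_combination h

theorem isGoodBoussinesqSolution_of_bilinear {F : ℝ × ℝ → ℝ} (hF : ContDiff ℝ ∞ F)
    (hpos : ∀ p, 0 < F p) (hbil : IsBilinearBoussinesqSolution F) :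
    IsGoodBoussinesqSolution
      (fun x t => 2 * iteratedDeriv 2 (fun y => Real.log (F (y, t))) x) := by
  set φ : ℝ × ℝ → ℝ := fun p => Real.log (F p) with hφdef
  have hφ : ContDiff ℝ ∞ φ := hF.log fun p => (hpos p).ne'
  have hlog : ∀ v, dirDeriv v F = F * dirDeriv v φ := by
    intro v
    funext p
    have := ((hF.differentiableAt_of_smooth p).hasFDerivAt.log (hpos p).ne').fderiv
    simp only [dirDeriv, Pi.mul_apply, hφdef, this, _root_.smul_apply, smul_eq_mul]
    field_simp [(hpos p).ne']
  have E := log_bilinear hF hφ hpos hlog hbil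
  set a := (dirDeriv (1, 0))^[2] φ with ha
  have sa : ContDiff ℝ ∞ a := (hφ.dirDeriv _).dirDeriv _
  have hu : ∀ x t, 2 * iteratedDeriv 2 (fun y => Real.log (F (y, t))) x = ((2 : ℝ) • a) (x, t) := by
    intro x t
    rw [iteratedDeriv_fst_slice hφ]
    simp [ha]
  simp only [hu]
  have su : ContDiff ℝ ∞ ((2 : ℝ) • a) := sa.pi_smul (2 : ℝ)
  refine ⟨contDiff_infty.mp su 4, fun x t => ?_⟩
  have sq : (fun y => (((2 : ℝ) • a) (y, t)) ^ 2) = fun y => ((4 : ℝ) • (a * a)) (y, t) := by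
    funext y
    simp
    ring
  have saa := sa.pi_mul sa
  rw [sq, iteratedDeriv_fst_slice su, iteratedDeriv_fst_slice su, iteratedDeriv_snd_slice su,
    iteratedDeriv_fst_slice (saa.pi_smul (4 : ℝ))]
  have s2 : ∀ v (g : ℝ × ℝ → ℝ), ContDiff ℝ ∞ g → ContDiff ℝ ∞ ((dirDeriv v)^[2] g) :=
    fun v g hg => (hg.dirDeriv _).dirDeriv _
  have add2 : ∀ v (f g : ℝ × ℝ → ℝ), ContDiff ℝ ∞ f → ContDiff ℝ ∞ g →
      (dirDeriv v)^[2] (f + g) = (dirDeriv v)^[2] f + (dirDeriv v)^[2] g := by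
    intro v f g hf hg
    simp only [Function.iterate_succ, Function.iterate_zero, Function.comp, id]
    rw [dirDeriv_add hf hg, dirDeriv_add (hf.dirDeriv _) (hg.dirDeriv _)]
  have smul2 : ∀ v (c : ℝ) (f : ℝ × ℝ → ℝ), ContDiff ℝ ∞ f →
      (dirDeriv v)^[2] (c • f) = c • (dirDeriv v)^[2] f := by
    intro v c f hf
    simp only [Function.iterate_succ, Function.iterate_zero, Function.comp, id]
    rw [dirDeriv_smul hf, dirDeriv_smul (hf.dirDeriv _)]
  have comm2 : (dirDeriv (1, 0))^[2] ((dirDeriv (0, 1))^[2] φ) = (dirDeriv (0, 1))^[2] a := by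
    simp only [ha, Function.iterate_succ, Function.iterate_zero, Function.comp, id]
    rw [dirDeriv_comm (hφ.dirDeriv _) (1, 0), dirDeriv_comm hφ (1, 0),
      dirDeriv_comm ((hφ.dirDeriv _).dirDeriv _) (1, 0), dirDeriv_comm (hφ.dirDeriv _) (1, 0)]
  have four : (dirDeriv (1, 0))^[4] φ = (dirDeriv (1, 0))^[2] a := rfl
  have four' : ∀ g, (dirDeriv (1, 0))^[4] g = (dirDeriv (1, 0))^[2] ((dirDeriv (1, 0))^[2] g) :=
    fun g => rfl
  have zero2 : (dirDeriv (1, 0))^[2] (0 : ℝ × ℝ → ℝ) = 0 := by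
    have := smul2 (1, 0) 0 0 contDiff_const
    simpa using this
  -- Twice the second `x`-derivative of the equation for `φ` is the Boussinesq equation for `u = 2
  -- φ_xx`.
  have E2 := congrFun (congrArg ((dirDeriv (1, 0))^[2]) E) (x, t)
  rw [four, zero2, add2 _ _ _ (((s2 _ _ hφ).pi_add (sa.pi_smul (-1 : ℝ))).pi_add
      ((s2 _ _ sa).pi_smul (1 / 3 : ℝ))) (saa.pi_smul (2 : ℝ)),
    add2 _ _ _ ((s2 _ _ hφ).pi_add (sa.pi_smul (-1 : ℝ))) ((s2 _ _ sa).pi_smul (1 / 3 : ℝ)),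
    add2 _ _ _ (s2 _ _ hφ) (sa.pi_smul (-1 : ℝ)), smul2 _ _ _ sa, smul2 _ _ _ (s2 _ _ sa),
    smul2 _ _ _ saa, comm2] at E2
  rw [smul2 _ _ _ sa, smul2 _ _ _ sa, smul2 _ _ _ saa, four', smul2 _ _ _ sa,
    smul2 _ _ _ (s2 _ _ sa)]
  simp only [Pi.add_apply, Pi.smul_apply, smul_eq_mul, Pi.zero_apply] at E2 ⊢
  linear_combination 2 * E2

/-! ### The bilinear equation for sums of exponentials. -/

/-- A sum of exponentials of affine functions of `(x, t)`. -/
noncomputable def expSum {ι : Type*} [Fintype ι] (c K W : ι → ℝ) (p : ℝ × ℝ) : ℝ :=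
  ∑ μ, c μ * Real.exp (K μ * p.1 + W μ * p.2)

theorem contDiff_expSum {ι : Type*} [Fintype ι] (c K W : ι → ℝ) :
    ContDiff ℝ ∞ (expSum c K W) := by
  unfold expSum
  fun_prop

theorem dirDeriv_expSum {ι : Type*} [Fintype ι] (c K W : ι → ℝ) (v : ℝ × ℝ) :
    dirDeriv v (expSum c K W) = expSum (fun μ => (K μ * v.1 + W μ * v.2) * c μ) K W := by
  funext p
  have h : HasFDerivAt (expSum c K W) (∑ μ, c μ • (Real.exp (K μ * p.1 + W μ * p.2) •
      (K μ • ContinuousLinearMap.fst ℝ ℝ ℝ + W μ • ContinuousLinearMap.snd ℝ ℝ ℝ))) p := by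
    unfold expSum
    refine HasFDerivAt.fun_sum fun μ _ => HasFDerivAt.const_mul (HasFDerivAt.exp ?_) _
    exact (hasFDerivAt_fst.const_mul (K μ)).add (hasFDerivAt_snd.const_mul (W μ))
  simp only [dirDeriv, h.fderiv, expSum, _root_.sum_apply]
  refine Finset.sum_congr rfl fun μ _ => ?_
  simp
  ring

theorem isBilinear_expSum {ι : Type*} [Fintype ι] (c K W : ι → ℝ)
    (h : ∀ x t, ∑ μ, ∑ ν, (c μ * Real.exp (K μ * x + W μ * t)) *
      (c ν * Real.exp (K ν * x + W ν * t)) *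
      ((W μ - W ν) ^ 2 - (K μ - K ν) ^ 2 + (1 / 3 : ℝ) * (K μ - K ν) ^ 4) = 0) :
    IsBilinearBoussinesqSolution (expSum c K W) := by
  rintro ⟨x, t⟩
  simp only [Function.iterate_succ, Function.iterate_zero, Function.comp, id, dirDeriv_expSum]
  have h := h x t
  set E : ι → ℝ := fun μ => c μ * Real.exp (K μ * x + W μ * t) with hE
  have conv : ∀ g : ι → ℝ, expSum (fun μ => g μ * c μ) K W (x, t) = ∑ μ, g μ * E μ := by
    intro g
    simp only [expSum, hE, mul_assoc]
  have conv0 : expSum c K W (x, t) = ∑ μ, E μ := by simp only [expSum, hE]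
  simp only [mul_one, mul_zero, add_zero, zero_add, ← mul_assoc, conv, conv0]
  have dbl : ∀ f g : ι → ℝ, (∑ μ, f μ) * (∑ ν, g ν) = ∑ μ, ∑ ν, f μ * g ν :=
    fun f g => Finset.sum_mul_sum _ _ _ _
  have expand : ∑ μ, ∑ ν, E μ * E ν *
      ((W μ - W ν) ^ 2 - (K μ - K ν) ^ 2 + (1 / 3 : ℝ) * (K μ - K ν) ^ 4)
      = (∑ μ, W μ * W μ * E μ) * (∑ μ, E μ) + (∑ μ, E μ) * (∑ μ, W μ * W μ * E μ)
        - 2 * ((∑ μ, W μ * E μ) * (∑ μ, W μ * E μ))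
        - (∑ μ, K μ * K μ * E μ) * (∑ μ, E μ) - (∑ μ, E μ) * (∑ μ, K μ * K μ * E μ)
        + 2 * ((∑ μ, K μ * E μ) * (∑ μ, K μ * E μ))
        + (1 / 3) * ((∑ μ, K μ * K μ * K μ * K μ * E μ) * (∑ μ, E μ))
        + (1 / 3) * ((∑ μ, E μ) * (∑ μ, K μ * K μ * K μ * K μ * E μ))
        - (4 / 3) * ((∑ μ, K μ * K μ * K μ * E μ) * (∑ μ, K μ * E μ))
        - (4 / 3) * ((∑ μ, K μ * E μ) * (∑ μ, K μ * K μ * K μ * E μ))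
        + 2 * ((∑ μ, K μ * K μ * E μ) * (∑ μ, K μ * K μ * E μ)) := by
    simp only [dbl, Finset.mul_sum, ← Finset.sum_add_distrib, ← Finset.sum_sub_distrib]
    refine Finset.sum_congr rfl fun μ _ => Finset.sum_congr rfl fun ν _ => ?_
    ring
  have h2 := expand.symm.trans h
  -- The double sum counts each ordered pair, hence is twice the bilinear expression.
  linear_combination (1 / 2) * h2

/-! ### Determinants with two free columns and the Plücker relation. -/

section Bracket

open Matrix

variable {ι R : Type*} [Fintype ι] [DecidableEq ι] [CommRing R]

/-- The determinant of `G` with the columns `a` and `b` replaced by `u` and `v`. -/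
def bracket (G : Matrix ι ι R) (a b : ι) (u v : ι → R) : R :=
  ((G.updateCol a u).updateCol b v).det

theorem bracket_eq_cramer_right (G : Matrix ι ι R) (a b : ι) (u v : ι → R) :
    bracket G a b u v = cramer (G.updateCol a u) v b :=
  rfl

theorem bracket_eq_cramer_left (G : Matrix ι ι R) {a b : ι} (hab : a ≠ b) (u v : ι → R) :
    bracket G a b u v = cramer (G.updateCol b v) u a := by
  rw [bracket, cramer_apply, updateCol_comm _ hab]

theorem bracket_self (G : Matrix ι ι R) {a b : ι} (hab : a ≠ b) (u : ι → R) :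
    bracket G a b u u = 0 :=
  det_zero_of_column_eq hab fun k => by simp [hab]

theorem bracket_col_left (G : Matrix ι ι R) {a b j : ι} (hab : a ≠ b) (hja : j ≠ a) (hjb : j ≠ b)
    (v : ι → R) : bracket G a b (fun i => G i j) v = 0 :=
  det_zero_of_column_eq hja fun k => by simp [hab, hja, hjb]

theorem bracket_add_left (G : Matrix ι ι R) {a b : ι} (hab : a ≠ b) (u u' v : ι → R) :
    bracket G a b (u + u') v = bracket G a b u v + bracket G a b u' v := by
  simp [bracket_eq_cramer_left G hab]

theorem bracket_smul_left (G : Matrix ι ι R) {a b : ι} (hab : a ≠ b) (c : R) (u v : ι → R) :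
    bracket G a b (c • u) v = c * bracket G a b u v := by
  simp [bracket_eq_cramer_left G hab]

theorem bracket_sum_left (G : Matrix ι ι R) {a b : ι} (hab : a ≠ b) {κ : Type*} (s : Finset κ)
    (u : κ → ι → R) (v : ι → R) :
    bracket G a b (∑ k ∈ s, u k) v = ∑ k ∈ s, bracket G a b (u k) v := by
  simp [bracket_eq_cramer_left G hab]

theorem bracket_add_right (G : Matrix ι ι R) (a b : ι) (u v v' : ι → R) :
    bracket G a b u (v + v') = bracket G a b u v + bracket G a b u v' := by
  simp [bracket_eq_cramer_right]

theorem bracket_smul_right (G : Matrix ι ι R) (a b : ι) (c : R) (u v : ι → R) :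
    bracket G a b u (c • v) = c * bracket G a b u v := by
  simp [bracket_eq_cramer_right]

theorem bracket_swap (G : Matrix ι ι R) {a b : ι} (hab : a ≠ b) (u v : ι → R) :
    bracket G a b u v = -bracket G a b v u := by
  have h := bracket_self G hab (u + v)
  rw [bracket_add_left G hab, bracket_add_right, bracket_add_right, bracket_self G hab,
    bracket_self G hab] at h
  linear_combination h

/-- The three-term Plücker relation. -/
theorem bracket_plucker (G : Matrix ι ι R) {a b : ι} (hab : a ≠ b) (u v c d : ι → R) :
    bracket G a b u v * bracket G a b c d - bracket G a b u c * bracket G a b v d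
      + bracket G a b v c * bracket G a b u d = 0 := by
  set M := (G.updateCol a u).updateCol b v with hM
  -- Cramer's rule, valid without invertibility of `M`. Inserted in the first slot of a bracket, it
  -- keeps only the columns `u` and `v`, since the others already occur in `G`.
  have hc : M.det • c = ∑ j, cramer M c j • (fun i => M i j) := by
    rw [← mulVec_cramer]
    funext i
    simp [mulVec, dotProduct, mul_comm]
  have h := congrArg (fun x => bracket G a b x d) hc
  simp only [bracket_smul_left G hab, bracket_sum_left G hab] at h
  have ha : (fun i => M i a) = u := by
    funext i
    simp [hM, hab]
  have hb : (fun i => M i b) = v := by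
    funext i
    simp [hM]
  rw [Finset.sum_eq_add a b hab, ha, hb] at h
  · have ya : cramer M c a = bracket G a b c v := by
      rw [cramer_apply, hM, bracket, updateCol_comm _ hab]
      simp [updateCol_comm _ hab.symm]
    have yb : cramer M c b = bracket G a b u c := by
      rw [cramer_apply, hM, bracket]
      simp
    rw [ya, yb, bracket_swap G hab c v] at h
    change bracket G a b u v * _ = _ at h
    linear_combination h
  · rintro j - ⟨hja, hjb⟩
    have hj : (fun i => M i j) = fun i => G i j := by
      funext i
      simp [hM, hja, hjb]
    rw [hj, bracket_col_left G hab hja hjb, mul_zero]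
  · simp
  · simp

end Bracket

/-! ### Alternants, power sums and the KP form. -/

section Alternant

open Matrix

/-- The determinant with columns `z ^ 0, …, z ^ (m - 1), z ^ α, z ^ β`. -/
def alternant (m α β : ℕ) (z : Fin (m + 2) → ℝ) : ℝ :=
  bracket (vandermonde z) (Fin.last m).castSucc (Fin.last (m + 1))
    (fun i => z i ^ α) (fun i => z i ^ β)

theorem castSucc_last_ne_last (m : ℕ) : (Fin.last m).castSucc ≠ Fin.last (m + 1) :=
  (Fin.castSucc_lt_last _).ne

theorem alternant_base (m : ℕ) (z : Fin (m + 2) → ℝ) :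
    alternant m m (m + 1) z = (vandermonde z).det := by
  unfold alternant bracket
  congr 1
  ext i j
  simp only [updateCol_apply, vandermonde_apply]
  split_ifs with h1 h2
  · simp [h1]
  · simp [h2]
  · rfl

/-- Each `z i` is a root of `∏ (X - z j)`, whose coefficients are the signed elementary symmetric
functions. -/
theorem pow_recurrence {m : ℕ} (z : Fin (m + 2) → ℝ) (i : Fin (m + 2)) :
    ∑ j ∈ Finset.range (m + 3),
      (-1) ^ j * ((Finset.univ.val.map z).esymm j * z i ^ (m + 2 - j)) = 0 := by
  have h := congrArg (Polynomial.eval (z i))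
    (Multiset.prod_X_sub_X_eq_sum_esymm (Finset.univ.val.map z))
  simp only [Multiset.card_map, Finset.card_val, Finset.card_univ, Fintype.card_fin,
    Polynomial.eval_finsetSum, Polynomial.eval_mul, Polynomial.eval_pow, Polynomial.eval_neg,
    Polynomial.eval_one, Polynomial.eval_C, Polynomial.eval_X] at h
  rw [← h, Polynomial.eval_multiset_prod, Multiset.prod_eq_zero]
  simp only [Multiset.map_map, Multiset.mem_map]
  exact ⟨i, by simp, by simp⟩

theorem multiset_esymm_zero (s : Multiset ℝ) : s.esymm 0 = 1 := by
  simp [Multiset.esymm]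

theorem esymm_eq_zero_of_card_lt {s : Multiset ℝ} {j : ℕ} (h : s.card < j) : s.esymm j = 0 := by
  rw [Multiset.esymm, Multiset.powersetCard_eq_empty j h]
  simp

theorem pow_succ_recurrence {m : ℕ} (z : Fin (m + 2) → ℝ) (i : Fin (m + 2)) :
    ∑ j ∈ Finset.range (m + 4),
      (-1) ^ j * ((Finset.univ.val.map z).esymm j * z i ^ (m + 3 - j)) = 0 := by
  -- The top term vanishes, as there are only `m + 2` points. It is included so that removing the
  -- four leading terms leaves exactly `m` lower powers.
  rw [Finset.sum_range_succ, esymm_eq_zero_of_card_lt (by simp), zero_mul, mul_zero, add_zero]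
  have h := congrArg (z i * ·) (pow_recurrence z i)
  simp only [mul_zero, Finset.mul_sum] at h
  rw [← h]
  refine Finset.sum_congr rfl fun j hj => ?_
  have : m + 3 - j = (m + 2 - j) + 1 := by
    have := Finset.mem_range.mp hj
    omega
  rw [this, pow_succ]
  ring

/-- A vector of the form `∑_{j < m} c_j z ^ (m - 1 - j)` does not contribute to an alternant. -/
theorem bracket_lower_left {m : ℕ} (z : Fin (m + 2) → ℝ) (c : ℕ → ℝ) (v : Fin (m + 2) → ℝ) :
    bracket (vandermonde z) (Fin.last m).castSucc (Fin.last (m + 1))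
      (∑ j ∈ Finset.range m, c j • fun i => z i ^ (m - 1 - j)) v = 0 := by
  rw [bracket_sum_left _ (castSucc_last_ne_last m)]
  refine Finset.sum_eq_zero fun j hj => ?_
  have hj := Finset.mem_range.mp hj
  rw [bracket_smul_left _ (castSucc_last_ne_last m)]
  have := bracket_col_left (vandermonde z) (j := ⟨m - 1 - j, by omega⟩) (castSucc_last_ne_last m)
    (by simp [Fin.ext_iff]; omega) (by simp [Fin.ext_iff]; omega) v
  simp only [vandermonde_apply] at this
  rw [this, mul_zero]

theorem bracket_lower_right {m : ℕ} (z : Fin (m + 2) → ℝ) (c : ℕ → ℝ) (u : Fin (m + 2) → ℝ) :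
    bracket (vandermonde z) (Fin.last m).castSucc (Fin.last (m + 1)) u
      (∑ j ∈ Finset.range m, c j • fun i => z i ^ (m - 1 - j)) = 0 := by
  rw [bracket_swap _ (castSucc_last_ne_last m), bracket_lower_left, neg_zero]

theorem pow_eq_esymm_add_lower {m : ℕ} (z : Fin (m + 2) → ℝ) : ∃ c : ℕ → ℝ,
    (fun i => z i ^ (m + 2)) =
      (Finset.univ.val.map z).esymm 1 • (fun i => z i ^ (m + 1))
        + (-(Finset.univ.val.map z).esymm 2) • (fun i => z i ^ m)
        + ∑ j ∈ Finset.range m, c j • fun i => z i ^ (m - 1 - j) := by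
  refine ⟨fun j => -((-1) ^ (j + 3) * (Finset.univ.val.map z).esymm (j + 3)), ?_⟩
  funext i
  have h := pow_recurrence z i
  rw [Finset.sum_range_succ', Finset.sum_range_succ', Finset.sum_range_succ'] at h
  have e : ∀ j, m + 2 - (j + 1 + 1 + 1) = m - 1 - j := fun j => by omega
  simp only [e] at h
  simp only [Pi.add_apply, Pi.smul_apply, Finset.sum_apply, smul_eq_mul, neg_mul,
    Finset.sum_neg_distrib, mul_assoc]
  generalize Finset.univ.val.map z = S at h ⊢
  simp [multiset_esymm_zero, add_assoc] at h ⊢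
  linear_combination h

theorem pow_succ_eq_esymm_add_lower {m : ℕ} (z : Fin (m + 2) → ℝ) : ∃ c : ℕ → ℝ,
    (fun i => z i ^ (m + 3)) =
      (Finset.univ.val.map z).esymm 1 • (fun i => z i ^ (m + 2))
        + (-(Finset.univ.val.map z).esymm 2) • (fun i => z i ^ (m + 1))
        + (Finset.univ.val.map z).esymm 3 • (fun i => z i ^ m)
        + ∑ j ∈ Finset.range m, c j • fun i => z i ^ (m - 1 - j) := by
  refine ⟨fun j => -((-1) ^ (j + 4) * (Finset.univ.val.map z).esymm (j + 4)), ?_⟩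
  funext i
  have h := pow_succ_recurrence z i
  rw [Finset.sum_range_succ', Finset.sum_range_succ', Finset.sum_range_succ',
    Finset.sum_range_succ'] at h
  have e : ∀ j, m + 3 - (j + 1 + 1 + 1 + 1) = m - 1 - j := fun j => by omega
  simp only [e] at h
  simp only [Pi.add_apply, Pi.smul_apply, Finset.sum_apply, smul_eq_mul, neg_mul,
    Finset.sum_neg_distrib, mul_assoc]
  generalize Finset.univ.val.map z = S at h ⊢
  simp [multiset_esymm_zero, add_assoc] at h ⊢
  linear_combination h

theorem newton_identities {n : ℕ} (z : Fin n → ℝ) :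
    ∑ i, z i = (Finset.univ.val.map z).esymm 1 ∧
    ∑ i, z i ^ 2 = (Finset.univ.val.map z).esymm 1 ^ 2 - 2 * (Finset.univ.val.map z).esymm 2 ∧
    ∑ i, z i ^ 3 = (Finset.univ.val.map z).esymm 1 ^ 3
      - 3 * (Finset.univ.val.map z).esymm 1 * (Finset.univ.val.map z).esymm 2
      + 3 * (Finset.univ.val.map z).esymm 3 := by
  have ev : ∀ k, MvPolynomial.eval z (MvPolynomial.esymm (Fin n) ℝ k)
      = (Finset.univ.val.map z).esymm k := fun k => by
    rw [← MvPolynomial.aeval_esymm_eq_multiset_esymm (Fin n) ℝ]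
    simp [MvPolynomial.aeval_eq_eval]
  have h2 := congrArg (MvPolynomial.eval z) (MvPolynomial.mul_esymm_eq_sum (Fin n) ℝ 2)
  have h3 := congrArg (MvPolynomial.eval z) (MvPolynomial.mul_esymm_eq_sum (Fin n) ℝ 3)
  have a2 : (Finset.HasAntidiagonal.antidiagonal 2).filter (fun a : ℕ × ℕ => a.1 < 2)
      = {(0, 2), (1, 1)} := by
    decide
  have a3 : (Finset.HasAntidiagonal.antidiagonal 3).filter (fun a : ℕ × ℕ => a.1 < 3)
      = {(0, 3), (1, 2), (2, 1)} := by
    decide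
  rw [a2] at h2
  rw [a3] at h3
  have h1 : ∑ i, z i = (Finset.univ.val.map z).esymm 1 := by
    rw [← ev]
    simp
  simp [MvPolynomial.psum] at h2 h3
  rw [ev] at h2
  rw [ev, ev] at h3
  rw [← h1]
  refine ⟨rfl, ?_, ?_⟩
  · linear_combination h2
  · linear_combination -h3 + (∑ i, z i) * h2

/-- The polynomial of the KP equation evaluated at the differences of the power sums of `x` and
`y`. -/
def kpForm {n : ℕ} (x y : Fin n → ℝ) : ℝ :=
  3 * (∑ i, x i ^ 2 - ∑ i, y i ^ 2) ^ 2
    - 4 * (∑ i, x i ^ 3 - ∑ i, y i ^ 3) * (∑ i, x i - ∑ i, y i)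
    + (∑ i, x i - ∑ i, y i) ^ 4

/-- These quotients by the Vandermonde are the Schur functions of the partitions (1), (1,1), (2),
(2,1), (2,2). Powers below `m` repeat a column, so the recurrences for `z ^ (m + 2)` and `z ^ (m +
3)` reduce everything to `alternant_base`. -/
theorem alternants_eq (m : ℕ) (z : Fin (m + 2) → ℝ) :
    alternant m m (m + 2) z = (Finset.univ.val.map z).esymm 1 * (vandermonde z).det ∧
    alternant m (m + 1) (m + 2) z = (Finset.univ.val.map z).esymm 2 * (vandermonde z).det ∧
    alternant m m (m + 3) z = ((Finset.univ.val.map z).esymm 1 ^ 2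
      - (Finset.univ.val.map z).esymm 2) * (vandermonde z).det ∧
    alternant m (m + 1) (m + 3) z = ((Finset.univ.val.map z).esymm 1
      * (Finset.univ.val.map z).esymm 2 - (Finset.univ.val.map z).esymm 3)
        * (vandermonde z).det ∧
    alternant m (m + 2) (m + 3) z = ((Finset.univ.val.map z).esymm 2 ^ 2
      - (Finset.univ.val.map z).esymm 1 * (Finset.univ.val.map z).esymm 3)
        * (vandermonde z).det := by
  obtain ⟨c, hc⟩ := pow_eq_esymm_add_lower z
  obtain ⟨d, hd⟩ := pow_succ_eq_esymm_add_lower z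
  have hab := castSucc_last_ne_last m
  have right2 : ∀ u, bracket (vandermonde z) (Fin.last m).castSucc (Fin.last (m + 1)) u
      (fun i => z i ^ (m + 2)) = (Finset.univ.val.map z).esymm 1 *
        bracket (vandermonde z) (Fin.last m).castSucc (Fin.last (m + 1)) u (fun i => z i ^ (m + 1))
      - (Finset.univ.val.map z).esymm 2 *
        bracket (vandermonde z) (Fin.last m).castSucc (Fin.last (m + 1)) u
          (fun i => z i ^ m) := by
    intro u
    rw [hc, bracket_add_right, bracket_add_right, bracket_smul_right, bracket_smul_right,
      bracket_lower_right]
    ring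
  have right3 : ∀ u, bracket (vandermonde z) (Fin.last m).castSucc (Fin.last (m + 1)) u
      (fun i => z i ^ (m + 3)) = (Finset.univ.val.map z).esymm 1 *
        bracket (vandermonde z) (Fin.last m).castSucc (Fin.last (m + 1)) u (fun i => z i ^ (m + 2))
      - (Finset.univ.val.map z).esymm 2 *
        bracket (vandermonde z) (Fin.last m).castSucc (Fin.last (m + 1)) u (fun i => z i ^ (m + 1))
      + (Finset.univ.val.map z).esymm 3 *
        bracket (vandermonde z) (Fin.last m).castSucc (Fin.last (m + 1)) u
          (fun i => z i ^ m) := by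
    intro u
    rw [hd, bracket_add_right, bracket_add_right, bracket_add_right, bracket_smul_right,
      bracket_smul_right, bracket_smul_right, bracket_lower_right]
    ring
  have base := alternant_base m z
  have self0 : alternant m m m z = 0 := bracket_self _ hab _
  have self1 : alternant m (m + 1) (m + 1) z = 0 := bracket_self _ hab _
  have self2 : alternant m (m + 2) (m + 2) z = 0 := bracket_self _ hab _
  have swap1 : alternant m (m + 1) m z = -alternant m m (m + 1) z := bracket_swap _ hab _ _
  have swap2 : alternant m (m + 2) m z = -alternant m m (m + 2) z := bracket_swap _ hab _ _
  have swap3 : alternant m (m + 2) (m + 1) z = -alternant m (m + 1) (m + 2) z :=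
    bracket_swap _ hab _ _
  have r2 : ∀ α, alternant m α (m + 2) z = (Finset.univ.val.map z).esymm 1 *
      alternant m α (m + 1) z - (Finset.univ.val.map z).esymm 2 * alternant m α m z :=
    fun α => right2 _
  have r3 : ∀ α, alternant m α (m + 3) z = (Finset.univ.val.map z).esymm 1 *
      alternant m α (m + 2) z - (Finset.univ.val.map z).esymm 2 * alternant m α (m + 1) z
      + (Finset.univ.val.map z).esymm 3 * alternant m α m z :=
    fun α => right3 _
  have h1 : alternant m m (m + 2) z
      = (Finset.univ.val.map z).esymm 1 * (vandermonde z).det := by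
    rw [r2, self0, base]; ring
  have h2 : alternant m (m + 1) (m + 2) z
      = (Finset.univ.val.map z).esymm 2 * (vandermonde z).det := by
    rw [r2, self1, swap1, base]; ring
  refine ⟨h1, h2, ?_, ?_, ?_⟩
  · rw [r3, h1, base, self0]; ring
  · rw [r3, h2, self1, swap1, base]; ring
  · rw [r3, self2, swap3, swap2, h1, h2]; ring

/-- Newton's identities and `alternants_eq` make both sides polynomials in the first three
elementary symmetric functions of `x` and `y`. The right side is the Plücker expression with its two
factors taken at different points, symmetrized in `x` and `y`. -/
theorem kpForm_mul_vandermonde (m : ℕ) (x y : Fin (m + 2) → ℝ) :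
    kpForm x y * ((vandermonde x).det * (vandermonde y).det) =
      12 * (alternant m (m + 2) (m + 3) x * alternant m m (m + 1) y
          - alternant m (m + 1) (m + 3) x * alternant m m (m + 2) y
          + alternant m m (m + 3) x * alternant m (m + 1) (m + 2) y)
      + 12 * (alternant m (m + 2) (m + 3) y * alternant m m (m + 1) x
          - alternant m (m + 1) (m + 3) y * alternant m m (m + 2) x
          + alternant m m (m + 3) y * alternant m (m + 1) (m + 2) x) := by
  obtain ⟨x1, x2, x3, x4, x5⟩ := alternants_eq m x
  obtain ⟨y1, y2, y3, y4, y5⟩ := alternants_eq m y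
  obtain ⟨p1, p2, p3⟩ := newton_identities x
  obtain ⟨q1, q2, q3⟩ := newton_identities y
  rw [x1, x2, x3, x4, x5, y1, y2, y3, y4, y5, alternant_base, alternant_base, kpForm, p1, p2, p3,
    q1, q2, q3]
  ring

/-- Alternants of a choice of points, summed over all choices with product weights. -/
theorem sum_alternant {m : ℕ} {κ : Type*} [Fintype κ] [DecidableEq κ] (g z : Fin (m + 2) → κ → ℝ)
    (α β : ℕ) :
    ∑ μ : Fin (m + 2) → κ, (∏ i, g i (μ i)) * alternant m α β (fun i => z i (μ i)) =
      bracket (of fun i (j : Fin (m + 2)) => ∑ s, g i s * z i s ^ (j : ℕ))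
        (Fin.last m).castSucc (Fin.last (m + 1))
        (fun i => ∑ s, g i s * z i s ^ α) (fun i => ∑ s, g i s * z i s ^ β) := by
  set e : Fin (m + 2) → ℕ := fun j => if j = Fin.last (m + 1) then β else
    if j = (Fin.last m).castSucc then α else j with he
  have hl : ∀ x : Fin (m + 2) → ℝ, alternant m α β x = det (of fun i j => x i ^ e j) := by
    intro x
    unfold alternant bracket
    congr 1
    ext i j
    simp only [updateCol_apply, vandermonde_apply, of_apply, he]
    split_ifs <;> rfl
  have hr : bracket (of fun i (j : Fin (m + 2)) => ∑ s, g i s * z i s ^ (j : ℕ))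
        (Fin.last m).castSucc (Fin.last (m + 1))
        (fun i => ∑ s, g i s * z i s ^ α) (fun i => ∑ s, g i s * z i s ^ β)
      = detRowAlternating (R := ℝ) (fun i => ∑ s, g i s • fun j => z i s ^ e j) := by
    unfold bracket
    refine Eq.trans ?_ (rfl : det _ = _)
    congr 1
    ext i j
    simp only [updateCol_apply, of_apply, he, Finset.sum_apply, Pi.smul_apply, smul_eq_mul]
    split_ifs <;> rfl
  rw [hr]
  have := (detRowAlternating (R := ℝ) (n := Fin (m + 2))).toMultilinearMap.map_sum
    (fun i s => g i s • fun j => z i s ^ e j)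
  refine Eq.trans ?_ this.symm
  refine Finset.sum_congr rfl fun μ _ => ?_
  rw [MultilinearMap.map_smul_univ, hl, smul_eq_mul]
  rfl

/-- After summation each product of alternants at `μ` and `ν` factors into two brackets of the same
matrix, so the symmetrized expression is a multiple of a genuine Plücker relation. -/
theorem sum_kpForm_eq_zero {m : ℕ} {κ : Type*} [Fintype κ] [DecidableEq κ]
    (g z : Fin (m + 2) → κ → ℝ) :
    ∑ μ : Fin (m + 2) → κ, ∑ ν : Fin (m + 2) → κ,
      ((∏ i, g i (μ i)) * (vandermonde fun i => z i (μ i)).det) *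
      ((∏ i, g i (ν i)) * (vandermonde fun i => z i (ν i)).det) *
      kpForm (fun i => z i (μ i)) (fun i => z i (ν i)) = 0 := by
  set T : ℕ → ℕ → ℝ := fun α β =>
    ∑ μ : Fin (m + 2) → κ, (∏ i, g i (μ i)) * alternant m α β (fun i => z i (μ i)) with hT
  have pl : T m (m + 1) * T (m + 2) (m + 3) - T m (m + 2) * T (m + 1) (m + 3)
      + T (m + 1) (m + 2) * T m (m + 3) = 0 := by
    simp only [hT, sum_alternant]
    exact bracket_plucker _ (castSucc_last_ne_last m) _ _ _ _
  have expand : ∑ μ : Fin (m + 2) → κ, ∑ ν : Fin (m + 2) → κ,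
      ((∏ i, g i (μ i)) * (vandermonde fun i => z i (μ i)).det) *
      ((∏ i, g i (ν i)) * (vandermonde fun i => z i (ν i)).det) *
      kpForm (fun i => z i (μ i)) (fun i => z i (ν i)) =
      12 * (T (m + 2) (m + 3) * T m (m + 1)) - 12 * (T (m + 1) (m + 3) * T m (m + 2))
        + 12 * (T m (m + 3) * T (m + 1) (m + 2))
        + 12 * (T m (m + 1) * T (m + 2) (m + 3)) - 12 * (T m (m + 2) * T (m + 1) (m + 3))
        + 12 * (T (m + 1) (m + 2) * T m (m + 3)) := by
    simp only [hT, Finset.sum_mul_sum]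
    simp only [Finset.mul_sum, ← Finset.sum_add_distrib,
      ← Finset.sum_sub_distrib]
    refine Finset.sum_congr rfl fun μ _ => Finset.sum_congr rfl fun ν _ => ?_
    linear_combination ((∏ i, g i (μ i)) * (∏ i, g i (ν i))) *
      kpForm_mul_vandermonde m (fun i => z i (μ i)) (fun i => z i (ν i))
  rw [expand]
  linear_combination 24 * pl

end Alternant

/-! ### Spectral parameters and the soliton coefficients. -/

section Soliton

open Matrix

theorem phaseRatio_eq {p₁ q₁ p₂ q₂ : ℝ} (h₁ : p₁ ^ 2 + p₁ * q₁ + q₁ ^ 2 = 3 / 4)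
    (h₂ : p₂ ^ 2 + p₂ * q₂ + q₂ ^ 2 = 3 / 4) (hk₁ : p₁ - q₁ ≠ 0) (hk₂ : p₂ - q₂ ≠ 0) :
    phaseRatio (p₁ - q₁) (p₁ ^ 2 - q₁ ^ 2) (p₂ - q₂) (p₂ ^ 2 - q₂ ^ 2) =
      ((p₁ - p₂) * (q₁ - q₂)) / ((p₁ - q₂) * (q₁ - p₂)) := by
  have num : (p₁ ^ 2 - q₁ ^ 2 - (p₂ ^ 2 - q₂ ^ 2)) ^ 2 - (p₁ - q₁ - (p₂ - q₂)) ^ 2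
      + (1 / 3 : ℝ) * (p₁ - q₁ - (p₂ - q₂)) ^ 4
      = 4 * (p₁ - q₁) * (p₂ - q₂) * ((p₁ - p₂) * (q₁ - q₂)) := by
    linear_combination (4 / 3) * (p₁ - q₁ - (p₂ - q₂)) * ((p₁ - q₁) * h₁ - (p₂ - q₂) * h₂)
  have den : (p₁ ^ 2 - q₁ ^ 2 + (p₂ ^ 2 - q₂ ^ 2)) ^ 2 - (p₁ - q₁ + (p₂ - q₂)) ^ 2
      + (1 / 3 : ℝ) * (p₁ - q₁ + (p₂ - q₂)) ^ 4
      = 4 * (p₁ - q₁) * (p₂ - q₂) * (-((p₁ - q₂) * (q₁ - p₂))) := by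
    linear_combination (4 / 3) * (p₁ - q₁ + (p₂ - q₂)) * ((p₁ - q₁) * h₁ + (p₂ - q₂) * h₂)
  rw [phaseRatio, num, den, mul_div_mul_left _ _ (by positivity), div_neg, neg_neg]

theorem exists_spectral_parameters {k w : ℝ} (hk : k ≠ 0)
    (hw : w ^ 2 = k ^ 2 * (1 - (1 / 3 : ℝ) * k ^ 2)) :
    ∃ p q : ℝ, k = p - q ∧ w = p ^ 2 - q ^ 2 ∧ p ^ 2 + p * q + q ^ 2 = 3 / 4 := by
  -- These solve `p - q = k`, `p + q = w / k`; the dispersion relation then places `(p, q)` on the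
  -- conic.
  refine ⟨(w / k + k) / 2, (w / k - k) / 2, by ring, by field_simp; ring, ?_⟩
  have h : (w / k) ^ 2 = 1 - (1 / 3 : ℝ) * k ^ 2 := by
    rw [div_pow, hw]
    field_simp
  linear_combination (3 / 4) * h

theorem phaseRatio_zero_left {k w : ℝ} (hw : w ^ 2 = k ^ 2 * (1 - (1 / 3 : ℝ) * k ^ 2)) :
    phaseRatio 0 0 k w = 0 := by
  have : (0 - w) ^ 2 - (0 - k) ^ 2 + (1 / 3 : ℝ) * (0 - k) ^ 4 = 0 := by linear_combination hw
  rw [phaseRatio, this, zero_div, neg_zero]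

theorem phaseRatio_zero_right {k w : ℝ} (hw : w ^ 2 = k ^ 2 * (1 - (1 / 3 : ℝ) * k ^ 2)) :
    phaseRatio k w 0 0 = 0 := by
  have : (w - 0) ^ 2 - (k - 0) ^ 2 + (1 / 3 : ℝ) * (k - 0) ^ 4 = 0 := by linear_combination hw
  rw [phaseRatio, this, zero_div, neg_zero]

/-- If `k i = 0` then `w i = 0`, and the numerator of the ratio with any other soliton is that
soliton's dispersion relation, contradicting positivity. A second soliton must exist, hence `m + 2`.
-/
theorem wavenumber_ne_zero {m : ℕ} {k w : Fin (m + 2) → ℝ}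
    (hw : ∀ i, w i ^ 2 = k i ^ 2 * (1 - (1 / 3 : ℝ) * k i ^ 2))
    (hA : ∀ i j, i < j → 0 < phaseRatio (k i) (w i) (k j) (w j)) (i : Fin (m + 2)) :
    k i ≠ 0 := by
  intro hk
  have hwi : w i = 0 := by
    have := hw i
    rw [hk] at this
    simpa using this
  obtain ⟨j, hj⟩ := exists_ne i
  rcases lt_or_gt_of_ne hj with h | h
  · have := hA j i h
    rw [hk, hwi, phaseRatio_zero_right (hw j)] at this
    exact this.false
  · have := hA i j h
    rw [hk, hwi, phaseRatio_zero_left (hw j)] at this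
    exact this.false

/-- The quartic form of the bilinear equation at the differences of the wave numbers and the
frequencies of two choices of solitons is the KP form at the corresponding points. -/
theorem three_mul_dispersion_eq_kpForm {n : ℕ} (p q : Fin n → ℝ)
    (hc : ∀ i, p i ^ 2 + p i * q i + q i ^ 2 = 3 / 4) (μ ν : Fin n → Fin 2) :
    3 * ((∑ i, ((μ i : ℕ) : ℝ) * (p i ^ 2 - q i ^ 2)
          - ∑ i, ((ν i : ℕ) : ℝ) * (p i ^ 2 - q i ^ 2)) ^ 2
        - (∑ i, ((μ i : ℕ) : ℝ) * (p i - q i) - ∑ i, ((ν i : ℕ) : ℝ) * (p i - q i)) ^ 2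
        + (1 / 3 : ℝ) *
          (∑ i, ((μ i : ℕ) : ℝ) * (p i - q i) - ∑ i, ((ν i : ℕ) : ℝ) * (p i - q i)) ^ 4) =
      kpForm (fun i => ![q i, p i] (μ i)) (fun i => ![q i, p i] (ν i)) := by
  have s1 : ∀ μ : Fin n → Fin 2, ∑ i, ![q i, p i] (μ i)
      = ∑ i, q i + ∑ i, ((μ i : ℕ) : ℝ) * (p i - q i) := by
    intro μ
    rw [← Finset.sum_add_distrib]
    refine Finset.sum_congr rfl fun i _ => ?_
    generalize μ i = s
    fin_cases s <;> simp
  have s2 : ∀ μ : Fin n → Fin 2, ∑ i, ![q i, p i] (μ i) ^ 2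
      = ∑ i, q i ^ 2 + ∑ i, ((μ i : ℕ) : ℝ) * (p i ^ 2 - q i ^ 2) := by
    intro μ
    rw [← Finset.sum_add_distrib]
    refine Finset.sum_congr rfl fun i _ => ?_
    generalize μ i = s
    fin_cases s <;> simp
  -- On the conic, cubes differ by `3/4` times the difference of the points; this removes the third
  -- power sum from the KP form.
  have s3 : ∀ μ : Fin n → Fin 2, ∑ i, ![q i, p i] (μ i) ^ 3
      = ∑ i, q i ^ 3 + (3 / 4) * ∑ i, ((μ i : ℕ) : ℝ) * (p i - q i) := by
    intro μ
    rw [Finset.mul_sum, ← Finset.sum_add_distrib]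
    refine Finset.sum_congr rfl fun i _ => ?_
    generalize μ i = s
    fin_cases s
    · simp
    · simp
      linear_combination (p i - q i) * hc i
  rw [kpForm, s1, s1, s2, s2, s3, s3]
  ring

/-- As a function of two bits, a difference of points is a constant times one factor per bit, up to
a correction at `(1, 1)`, which is the cross-ratio `R`. -/
theorem vandermonde_factor {p₁ q₁ p₂ q₂ R : ℝ} (hq : q₁ - q₂ ≠ 0) (h₁ : p₁ - q₂ ≠ 0)
    (h₂ : q₁ - p₂ ≠ 0) (hR : R = ((p₁ - p₂) * (q₁ - q₂)) / ((p₁ - q₂) * (q₁ - p₂)))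
    (s r : Fin 2) :
    ![q₂, p₂] r - ![q₁, p₁] s = (q₂ - q₁) * ((p₁ - q₂) / (q₁ - q₂)) ^ (s : ℕ) *
      ((q₁ - p₂) / (q₁ - q₂)) ^ (r : ℕ) * R ^ ((s : ℕ) * (r : ℕ)) := by
  subst hR
  fin_cases s <;> fin_cases r <;> simp <;> field_simp <;> ring

theorem prod_prod_Ioi_comm {n : ℕ} (f : Fin n → Fin n → ℝ) :
    ∏ i, ∏ j ∈ Finset.Ioi i, f i j = ∏ j, ∏ i ∈ Finset.Iio j, f i j :=
  Finset.prod_comm' (by simp)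

/-- Up to a constant, the coefficients of the soliton sum are Vandermonde determinants with product
weights. -/
theorem exists_vandermonde_weights {n : ℕ} (p q η : Fin n → ℝ) (A : Fin n → Fin n → ℝ)
    (hq : ∀ i j, i < j → q i - q j ≠ 0) (h₁ : ∀ i j, i < j → p i - q j ≠ 0)
    (h₂ : ∀ i j, i < j → q i - p j ≠ 0)
    (hR : ∀ i j, i < j → Real.exp (A i j)
      = ((p i - p j) * (q i - q j)) / ((p i - q j) * (q i - p j))) :
    ∃ C : ℝ, C ≠ 0 ∧ ∃ g : Fin n → Fin 2 → ℝ, ∀ μ : Fin n → Fin 2,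
      C * Real.exp (∑ i, ((μ i : ℕ) : ℝ) * η i
        + ∑ i, ∑ j ∈ Finset.Ioi i, ((μ i : ℕ) : ℝ) * ((μ j : ℕ) : ℝ) * A i j) =
      (∏ i, g i (μ i)) * (vandermonde fun i => ![q i, p i] (μ i)).det := by
  set a : Fin n → ℝ := fun i => ∏ j ∈ Finset.Ioi i, (p i - q j) / (q i - q j) with ha
  set b : Fin n → ℝ := fun j => ∏ i ∈ Finset.Iio j, (q i - p j) / (q i - q j) with hb
  have ha0 : ∀ i, a i ≠ 0 := fun i => Finset.prod_ne_zero_iff.mpr fun j hj =>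
    div_ne_zero (h₁ i j (Finset.mem_Ioi.mp hj)) (hq i j (Finset.mem_Ioi.mp hj))
  have hb0 : ∀ i, b i ≠ 0 := fun j => Finset.prod_ne_zero_iff.mpr fun i hi =>
    div_ne_zero (h₂ i j (Finset.mem_Iio.mp hi)) (hq i j (Finset.mem_Iio.mp hi))
  -- The constant is the Vandermonde of the `q i`, that is, the case `μ = 0`. The weights cancel the
  -- one-bit factors `a i` and `b i`.
  refine ⟨∏ i, ∏ j ∈ Finset.Ioi i, (q j - q i), ?_,
    fun i s => (Real.exp (η i) / (a i * b i)) ^ (s : ℕ), fun μ => ?_⟩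
  · refine Finset.prod_ne_zero_iff.mpr fun i _ => Finset.prod_ne_zero_iff.mpr fun j hj => ?_
    rw [← neg_sub]
    exact neg_ne_zero.mpr (hq i j (Finset.mem_Ioi.mp hj))
  have hV : (vandermonde fun i => ![q i, p i] (μ i)).det
      = (∏ i, ∏ j ∈ Finset.Ioi i, (q j - q i)) * (∏ i, a i ^ (μ i : ℕ)) * (∏ i, b i ^ (μ i : ℕ))
        * ∏ i, ∏ j ∈ Finset.Ioi i, Real.exp (A i j) ^ ((μ i : ℕ) * (μ j : ℕ)) := by
    have e1 : ∏ i, a i ^ (μ i : ℕ)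
        = ∏ i, ∏ j ∈ Finset.Ioi i, ((p i - q j) / (q i - q j)) ^ (μ i : ℕ) := by
      simp only [ha, Finset.prod_pow]
    have e2 : ∏ i, b i ^ (μ i : ℕ)
        = ∏ i, ∏ j ∈ Finset.Ioi i, ((q i - p j) / (q i - q j)) ^ (μ j : ℕ) := by
      rw [prod_prod_Ioi_comm]
      simp only [hb, Finset.prod_pow]
    rw [det_vandermonde, e1, e2]
    simp only [← Finset.prod_mul_distrib]
    refine Finset.prod_congr rfl fun i _ => Finset.prod_congr rfl fun j hj => ?_
    have hij := Finset.mem_Ioi.mp hj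
    exact vandermonde_factor (hq i j hij) (h₁ i j hij) (h₂ i j hij) (hR i j hij) _ _
  have hE : Real.exp (∑ i, ((μ i : ℕ) : ℝ) * η i
        + ∑ i, ∑ j ∈ Finset.Ioi i, ((μ i : ℕ) : ℝ) * ((μ j : ℕ) : ℝ) * A i j)
      = (∏ i, Real.exp (η i) ^ (μ i : ℕ)) *
        ∏ i, ∏ j ∈ Finset.Ioi i, Real.exp (A i j) ^ ((μ i : ℕ) * (μ j : ℕ)) := by
    rw [Real.exp_add, Real.exp_sum, Real.exp_sum]
    simp only [Real.exp_sum, ← Real.exp_nat_mul, Nat.cast_mul]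
  have hg : (∏ i, (Real.exp (η i) / (a i * b i)) ^ (μ i : ℕ)) * (∏ i, a i ^ (μ i : ℕ))
      * (∏ i, b i ^ (μ i : ℕ)) = ∏ i, Real.exp (η i) ^ (μ i : ℕ) := by
    simp only [← Finset.prod_mul_distrib]
    refine Finset.prod_congr rfl fun i _ => ?_
    rw [← mul_pow, ← mul_pow, mul_assoc, div_mul_cancel₀ _ (mul_ne_zero (ha0 i) (hb0 i))]
  rw [hV, hE, ← hg]
  ring

/-- Hirota's condition for the soliton coefficients of the good Boussinesq equation. -/
theorem soliton_hirota_condition (n : ℕ) (k w η : Fin n → ℝ)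
    (hw : ∀ i, w i ^ 2 = k i ^ 2 * (1 - (1 / 3 : ℝ) * k i ^ 2))
    (hA : ∀ i j, i < j → 0 < phaseRatio (k i) (w i) (k j) (w j)) :
    ∑ μ : Fin n → Fin 2, ∑ ν : Fin n → Fin 2,
      Real.exp (∑ i, ((μ i : ℕ) : ℝ) * η i
        + ∑ i, ∑ j ∈ Finset.Ioi i, ((μ i : ℕ) : ℝ) * ((μ j : ℕ) : ℝ) * phaseShift k w i j) *
      Real.exp (∑ i, ((ν i : ℕ) : ℝ) * η i
        + ∑ i, ∑ j ∈ Finset.Ioi i, ((ν i : ℕ) : ℝ) * ((ν j : ℕ) : ℝ) * phaseShift k w i j) *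
      ((∑ i, ((μ i : ℕ) : ℝ) * w i - ∑ i, ((ν i : ℕ) : ℝ) * w i) ^ 2
        - (∑ i, ((μ i : ℕ) : ℝ) * k i - ∑ i, ((ν i : ℕ) : ℝ) * k i) ^ 2
        + (1 / 3 : ℝ) * (∑ i, ((μ i : ℕ) : ℝ) * k i - ∑ i, ((ν i : ℕ) : ℝ) * k i) ^ 4) = 0 := by
  match n with
  | 0 => simp
  -- Here `k 0` may vanish, so spectral parameters are unavailable; the quartic is zero for equal
  -- bits and is the dispersion relation otherwise.
  | 1 =>
    refine Finset.sum_eq_zero fun μ _ => Finset.sum_eq_zero fun ν _ => mul_eq_zero_of_right _ ?_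
    simp only [Fin.sum_univ_one]
    have h := hw 0
    generalize μ 0 = s
    generalize ν 0 = r
    fin_cases s <;> fin_cases r <;> simp <;> linear_combination h
  | m + 2 =>
    choose p q hk hwpq hc using fun i => exists_spectral_parameters (wavenumber_ne_zero hw hA i)
      (hw i)
    have hne : ∀ i, p i - q i ≠ 0 := fun i => hk i ▸ wavenumber_ne_zero hw hA i
    have ratio : ∀ i j, phaseRatio (k i) (w i) (k j) (w j)
        = ((p i - p j) * (q i - q j)) / ((p i - q j) * (q i - p j)) := fun i j => by
      rw [hk i, hk j, hwpq i, hwpq j]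
      exact phaseRatio_eq (hc i) (hc j) (hne i) (hne j)
    have nz : ∀ i j, i < j → q i - q j ≠ 0 ∧ p i - q j ≠ 0 ∧ q i - p j ≠ 0 := by
      intro i j hij
      -- Division by zero gives zero, so a positive ratio has non-zero numerator and denominator.
      have h := (hA i j hij).ne'
      rw [ratio] at h
      obtain ⟨hn, hd⟩ := div_ne_zero_iff.mp h
      exact ⟨right_ne_zero_of_mul hn, left_ne_zero_of_mul hd, right_ne_zero_of_mul hd⟩
    obtain ⟨C, hC, g, hg⟩ := exists_vandermonde_weights p q η (phaseShift k w)
      (fun i j h => (nz i j h).1) (fun i j h => (nz i j h).2.1) (fun i j h => (nz i j h).2.2)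
      (fun i j h => by
        rw [← ratio, phaseShift, abs_of_pos (hA i j h), Real.exp_log (hA i j h)])
    have key := sum_kpForm_eq_zero g (fun i => ![q i, p i])
    simp only [← hg, ← three_mul_dispersion_eq_kpForm p q hc, ← hk, ← hwpq] at key
    have hC2 : 3 * C ^ 2 ≠ 0 := by positivity
    apply mul_left_cancel₀ hC2
    rw [mul_zero, ← key, Finset.mul_sum]
    refine Finset.sum_congr rfl fun μ _ => ?_
    rw [Finset.mul_sum]
    refine Finset.sum_congr rfl fun ν _ => ?_
    ring

theorem exponent_eq {n : ℕ} (k w η₀ : Fin n → ℝ) (x t : ℝ) (μ : Fin n → Fin 2) :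
    ∑ i, ((μ i : ℕ) : ℝ) * solitonPhase k w η₀ x t i =
      ∑ i, ((μ i : ℕ) : ℝ) * η₀ i
        + ((∑ i, ((μ i : ℕ) : ℝ) * k i) * x + (∑ i, ((μ i : ℕ) : ℝ) * w i) * t) := by
  simp only [solitonPhase, Finset.sum_mul, ← Finset.sum_add_distrib]
  exact Finset.sum_congr rfl fun i _ => by ring

end Soliton

theorem mainTheorem6 (n : ℕ) (k w η₀ : Fin n → ℝ)
    (hw : ∀ i, w i ^ 2 = k i ^ 2 * (1 - (1 / 3 : ℝ) * k i ^ 2))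
    (hA : ∀ i j, i < j → 0 < phaseRatio (k i) (w i) (k j) (w j)) :
    IsGoodBoussinesqSolution (nSoliton k w η₀) := by
  set K : (Fin n → Fin 2) → ℝ := fun μ => ∑ i, ((μ i : ℕ) : ℝ) * k i with hK
  set W : (Fin n → Fin 2) → ℝ := fun μ => ∑ i, ((μ i : ℕ) : ℝ) * w i with hW
  set c : (Fin n → Fin 2) → ℝ := fun μ => Real.exp (∑ i, ((μ i : ℕ) : ℝ) * η₀ i
    + ∑ i, ∑ j ∈ Finset.Ioi i, ((μ i : ℕ) : ℝ) * ((μ j : ℕ) : ℝ) * phaseShift k w i j) with hc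
  have term : ∀ x t μ, c μ * Real.exp (K μ * x + W μ * t) =
      Real.exp (∑ i, ((μ i : ℕ) : ℝ) * solitonPhase k w η₀ x t i
        + ∑ i, ∑ j ∈ Finset.Ioi i, ((μ i : ℕ) : ℝ) * ((μ j : ℕ) : ℝ) * phaseShift k w i j) := by
    intro x t μ
    rw [hc, ← Real.exp_add, exponent_eq]
    congr 1
    ring
  have tau : ∀ x t, solitonTau k w η₀ x t = expSum c K W (x, t) := fun x t =>
    (Finset.sum_congr rfl fun μ _ => term x t μ).symm
  have pos : ∀ p, 0 < expSum c K W p := fun p =>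
    Finset.sum_pos (fun μ _ => mul_pos (Real.exp_pos _) (Real.exp_pos _)) Finset.univ_nonempty
  have bil : IsBilinearBoussinesqSolution (expSum c K W) := by
    refine isBilinear_expSum c K W fun x t => ?_
    simp only [term]
    -- At a fixed point `(x, t)` the exponentials are absorbed in the phases, so the condition is
    -- used with `η` equal to the phases there.
    exact soliton_hirota_condition n k w (solitonPhase k w η₀ x t) hw hA
  have sol := isGoodBoussinesqSolution_of_bilinear (contDiff_expSum c K W) pos bil
  have : nSoliton k w η₀ =
      fun x t => 2 * iteratedDeriv 2 (fun y => Real.log (expSum c K W (y, t))) x := by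
    funext x t
    simp only [nSoliton, tau]
  rw [this]
  exact sol
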